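/- **Lemma 1.** Let $R$ and $A$ be systems of $N_A$ qubits and $B$ a system of $N_B$ qubits, $d_A=2^{N_A}$, $d_B=2^{N_B}$. Let $|\Phi\rangle_{RA}=d_A^{-1/2}\sum_i|i\rangle_R|i\rangle_A$, let $U$ be a unitary on $AB$, and measure $B$ in the computational basis in the state $(I_R\otimes U)|\Phi\rangle_{RA}|0\rangle_B$. Let $p_z$ be the probability of the outcome $z$, $|\psi_z\rangle_{RA_{\rm out}}$ the normalized conditional state, $\rho_{A_{\rm out}|z}=\mathrm{tr}_R|\psi_z\rangle\langle\psi_z|$, and $\mathbb E_z$ the average with weights $p_z$. Let $S(\rho)=-\mathrm{tr}(\rho\log_2\rho)$ and $S_2(\rho)=-\log_2\mathrm{tr}(\rho^2)$, and let $I(R:A_{\rm out}|z)=S(\rho_{R|z})+S(\rho_{A_{\rm out}|z})-S(|\psi_z\rangle\langle\psi_z|)$ be the quantum mutual information of $|\psi_z\rangle$. 1. For every $N_A,N_B$ and every unitary $U$, $\mathbb E_z I(R:A_{\rm out}|z)\ge \mathbb E_z\,2S_2(\rho_{A_{\rm out}|z})$. 2. Both sides are integrable over Haar-random $U$, and there is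 a universal constant $C\ge 0$ such that for all $N_A,N_B$ $$\mathbb E_{\rm Haar}\mathbb E_z I(R:A_{\rm out}|z)\ \ge\ \mathbb E_{\rm Haar}\mathbb E_z\,2S_2(\rho_{A_{\rm out}|z})\ \ge\ 2(N_A-1)-2\log_2\Big(1-\frac1{2d_B}+\frac{C}{d_A^2}\Big).$$ 3. The initial mutual information of $|\Phi\rangle_{RA}$ is $2N_A$, and its Haar-averaged decrease $2N_A-\mathbb E_{\rm Haar}\mathbb E_z I(R:A_{\rm out}|z)$ is asymptotically at most $2$ as $d_A\to\infty$, whatever the ancilla size: it is at most $2+C'/d_A^2$ for all $N_A,N_B$ with a universal constant $C'\ge 0$, and for each fixed $N_B$ it is at most $2$ for all sufficiently large $N_A$. -/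

import Mathlib

open MeasureTheory Matrix Filter
open scoped Kronecker

/-- Labels of the computational basis of `N` qubits: bit strings of length `N`. -/
abbrev Qubits (N : ℕ) : Type := Fin N → Fin 2

/-! ### Haar measure on the unitary group -/

noncomputable section Haar

variable {n : Type*} [Fintype n] [DecidableEq n]

/-- The Borel sigma-algebra on the unitary group. -/
instance unitaryGroupMeasurableSpace : MeasurableSpace (Matrix.unitaryGroup n ℂ) := borel _

instance unitaryGroupBorelSpace : BorelSpace (Matrix.unitaryGroup n ℂ) := ⟨rfl⟩

instance unitaryGroupCompactSpace : CompactSpace (Matrix.unitaryGroup n ℂ) := by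
  refine isCompact_iff_compactSpace.mp ?_
  have hK : IsCompact
      (Set.univ.pi fun _ : n => Set.univ.pi fun _ : n => Metric.closedBall (0 : ℂ) 1) :=
    isCompact_univ_pi fun _ => isCompact_univ_pi fun _ => isCompact_closedBall _ _
  refine IsCompact.of_isClosed_subset hK ?_ ?_
  · exact isClosed_unitary (R := Matrix n n ℂ)
  · intro U hU i _ j _
    simpa using entry_norm_bound_of_unitary hU i j

/-- The Haar probability measure on the unitary group. -/
def haarUnitary (n : Type*) [Fintype n] [DecidableEq n] :
    Measure (Matrix.unitaryGroup n ℂ) :=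
  Measure.haarMeasure ⊤

end Haar

noncomputable section

/-! ### States, partial traces, entropies (in bits) -/

/-- The operator `|ψ⟩⟨ψ|`. -/
def pureDensity {n : Type*} (ψ : n → ℂ) : Matrix n n ℂ :=
  Matrix.vecMulVec ψ (star ψ)

/-- Partial trace over the second tensor factor. -/
def traceSnd {m n : Type*} [Fintype n] (ρ : Matrix (m × n) (m × n) ℂ) : Matrix m m ℂ :=
  Matrix.of fun i j => ∑ k, ρ (i, k) (j, k)

/-- Partial trace over the first tensor factor. -/
def traceFst {m n : Type*} [Fintype m] (ρ : Matrix (m × n) (m × n) ℂ) : Matrix n n ℂ :=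
  Matrix.of fun i j => ∑ k, ρ (k, i) (k, j)

/-- Von Neumann entropy `S(ρ) = - tr (ρ log₂ ρ)`, through the functional calculus. -/
def vnEntropy {n : Type*} [Fintype n] [DecidableEq n] (ρ : Matrix n n ℂ) : ℝ :=
  (cfc Real.negMulLog ρ).trace.re / Real.log 2

/-- Rényi-2 entropy `S₂(ρ) = - log₂ tr (ρ²)`. -/
def renyi2 {n : Type*} [Fintype n] (ρ : Matrix n n ℂ) : ℝ :=
  -Real.logb 2 (ρ * ρ).trace.re

/-- Quantum mutual information `I(R : A) = S(ρ_R) + S(ρ_A) - S(ρ_{RA})`. -/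
def mutualInfo {m n : Type*} [Fintype m] [DecidableEq m] [Fintype n] [DecidableEq n]
    (ρ : Matrix (m × n) (m × n) ℂ) : ℝ :=
  vnEntropy (traceSnd ρ) + vnEntropy (traceFst ρ) - vnEntropy ρ

/-! ### Deep thermalization with a reference -/

/-- The maximally entangled state `d_A^{-1/2} ∑ᵢ |i⟩_R |i⟩_A`, where `d_A = 2 ^ NA`. -/
def maxEntangled (NA : ℕ) : Qubits NA × Qubits NA → ℂ :=
  fun x => if x.1 = x.2 then ((1 / Real.sqrt (2 ^ NA) : ℝ) : ℂ) else 0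

/-- The state `|0…0⟩` of `NB` qubits. -/
def zeroState (NB : ℕ) : Qubits NB → ℂ :=
  fun b => if b = 0 then 1 else 0

/-- The initial state `|Φ⟩_{RA} |0⟩_B`, on `R ⊗ (A ⊗ B)`. -/
def inputState (NA NB : ℕ) : Qubits NA × (Qubits NA × Qubits NB) → ℂ :=
  fun x => maxEntangled NA (x.1, x.2.1) * zeroState NB x.2.2

/-- The state `(1_R ⊗ U) |Φ⟩_{RA} |0⟩_B` before the measurement. -/
def outputState {NA NB : ℕ} (U : Matrix.unitaryGroup (Qubits NA × Qubits NB) ℂ) :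
    Qubits NA × (Qubits NA × Qubits NB) → ℂ :=
  ((1 : Matrix (Qubits NA) (Qubits NA) ℂ) ⊗ₖ
    (U : Matrix (Qubits NA × Qubits NB) (Qubits NA × Qubits NB) ℂ)) *ᵥ inputState NA NB

/-- The unnormalized conditional state `⟨z|_B (1_R ⊗ U) |Φ⟩_{RA} |0⟩_B`. -/
def projectedState {NA NB : ℕ} (U : Matrix.unitaryGroup (Qubits NA × Qubits NB) ℂ)
    (z : Qubits NB) : Qubits NA × Qubits NA → ℂ :=
  fun x => outputState U (x.1, (x.2, z))

/-- The probability `p_z` of the measurement outcome `z` on the ancilla. -/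
def outcomeProb {NA NB : ℕ} (U : Matrix.unitaryGroup (Qubits NA × Qubits NB) ℂ)
    (z : Qubits NB) : ℝ :=
  ∑ x, ‖projectedState U z x‖ ^ 2

/-- The conditional state `|ψ_z⟩` of `R ⊗ A_out` (of no weight in any average if `p_z = 0`). -/
def conditionalState {NA NB : ℕ} (U : Matrix.unitaryGroup (Qubits NA × Qubits NB) ℂ)
    (z : Qubits NB) : Qubits NA × Qubits NA → ℂ :=
  fun x => projectedState U z x / (Real.sqrt (outcomeProb U z) : ℂ)

/-- `E_z I(R : A_out | z)`: the mutual information of the conditional state, averaged over the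
measurement outcomes. -/
def avgMutualInfo {NA NB : ℕ} (U : Matrix.unitaryGroup (Qubits NA × Qubits NB) ℂ) : ℝ :=
  ∑ z, outcomeProb U z * mutualInfo (pureDensity (conditionalState U z))

/-- `E_z 2 S₂(ρ_{A_out | z})`, where `ρ_{A_out | z} = tr_R |ψ_z⟩⟨ψ_z|`. -/
def avgTwiceRenyi2 {NA NB : ℕ} (U : Matrix.unitaryGroup (Qubits NA × Qubits NB) ℂ) : ℝ :=
  ∑ z, outcomeProb U z * (2 * renyi2 (traceFst (pureDensity (conditionalState U z))))

end

/-! A pure state of `RA` has zero entropy and two marginals of equal purity, so S₂ ≤ S on each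
marginal already gives I ≥ 2 S₂ for every outcome of every unitary.

For the Haar average, let P be the probability of an outcome and Q the purity of the unnormalized
reduced state. The weighted entropy P·S₂ = -P log₂(Q/P²) is jointly convex in (P, Q), so it lies
above its tangent plane at any (p, q); this is `affine_le_outcomeProb_mul_renyi2`. Take p = E P =
1/d_B and q = (2 - 1/d_B)/(d_A d_B²). The plane decreases in Q, so E Q ≤ q
(`integral_projectedPurity_le`) is all that is needed, and each outcome contributes at least -p
log₂(q/p²).

E Q is a sum of fourth-order moments of the entries of U. They follow from left invariance under
permutations of rows and reflections mixing two rows, together with orthonormality of columns. The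
bound on E Q has no error term in d_A, so both constants can be taken to be 0. -/

/-! ### Spectral expressions for traces and a tangent inequality for the logarithm. -/

theorem neg_mul_log_sub_le_negMulLog {x s : ℝ} (hx : 0 ≤ x) (hs : 0 < s) :
    -x * Real.log s - x * (x / s - 1) ≤ Real.negMulLog x := by
  rcases hx.eq_or_lt with rfl | hx
  · simp
  · have h := Real.log_le_sub_one_of_pos (div_pos hx hs)
    rw [Real.log_div hx.ne' hs.ne'] at h
    have := mul_le_mul_of_nonneg_left h hx.le
    rw [Real.negMulLog]
    linarith

namespace Matrix.IsHermitian

variable {n : Type*} [Fintype n] [DecidableEq n] {A : Matrix n n ℂ}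

theorem re_trace_cfc (hA : A.IsHermitian) (f : ℝ → ℝ) :
    (cfc f A).trace.re = ∑ i, f (hA.eigenvalues i) := by
  rw [hA.cfc_eq, Matrix.IsHermitian.cfc, Unitary.conjStarAlgAut_apply, Matrix.trace_mul_comm,
    ← mul_assoc]
  simp [Matrix.trace_diagonal]

theorem re_trace_eq_sum_eigenvalues (hA : A.IsHermitian) :
    A.trace.re = ∑ i, hA.eigenvalues i := by
  rw [hA.trace_eq_sum_eigenvalues]
  simp

theorem re_trace_mul_self (hA : A.IsHermitian) :
    (A * A).trace.re = ∑ i, hA.eigenvalues i ^ 2 := by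
  have h : cfc (fun x : ℝ => x ^ 2) A = A * A := by
    rw [cfc_pow_id A 2 hA.isSelfAdjoint, sq]
  rw [← h, hA.re_trace_cfc]

end Matrix.IsHermitian

theorem measurable_renyi2 {n Ω : Type*} [Fintype n]
    [MeasurableSpace Ω] {ρ : Ω → Matrix n n ℂ}
    (hm : ∀ i j, Measurable fun ω => ρ ω i j) : Measurable fun ω => renyi2 (ρ ω) := by
  refine Measurable.neg (Measurable.div_const (Real.measurable_log.comp ?_) _)
  simp only [Matrix.trace, Matrix.diag, Matrix.mul_apply, Complex.re_sum]
  exact Finset.measurable_sum _ fun i _ => Finset.measurable_sum _ fun j _ =>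
    Complex.measurable_re.comp ((hm i j).mul (hm j i))

/-! ### Von Neumann and Rényi-2 entropies of a density matrix. -/

section Entropy

open scoped ComplexOrder

variable {n : Type*} [Fintype n] [DecidableEq n] {ρ : Matrix n n ℂ}

theorem re_trace_mul_self_pos (hρ : ρ.PosSemidef) (h1 : ρ.trace = 1) :
    0 < (ρ * ρ).trace.re := by
  have hs := hρ.1.re_trace_eq_sum_eigenvalues
  rw [h1, Complex.one_re] at hs
  rw [hρ.1.re_trace_mul_self]
  refine lt_of_le_of_ne (Finset.sum_nonneg fun i _ => sq_nonneg _) fun h => ?_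
  have h0 := (Finset.sum_eq_zero_iff_of_nonneg fun i _ => sq_nonneg _).1 h.symm
  rw [Finset.sum_eq_zero fun i hi => by simpa using h0 i hi] at hs
  exact one_ne_zero hs

/-- Jensen's inequality in tangent form: log x ≤ log s + x/s - 1 at s = tr ρ², weighted by the
eigenvalues x. The corrections cancel because the eigenvalues sum to 1 and their squares to s. -/
theorem renyi2_le_vnEntropy (hρ : ρ.PosSemidef) (h1 : ρ.trace = 1) :
    renyi2 ρ ≤ vnEntropy ρ := by
  have hpos := re_trace_mul_self_pos hρ h1
  rw [renyi2, vnEntropy, Real.logb, ← neg_div]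
  refine div_le_div_of_nonneg_right ?_ (Real.log_pos one_lt_two).le
  have hs := hρ.1.re_trace_eq_sum_eigenvalues
  have hq := hρ.1.re_trace_mul_self
  rw [h1, Complex.one_re] at hs
  rw [hρ.1.re_trace_cfc]
  generalize (ρ * ρ).trace.re = s at hpos hq
  calc -Real.log s = ∑ i, (-hρ.1.eigenvalues i * Real.log s
        - hρ.1.eigenvalues i * (hρ.1.eigenvalues i / s - 1)) := by
        have h : ∀ i, -hρ.1.eigenvalues i * Real.log s
          - hρ.1.eigenvalues i * (hρ.1.eigenvalues i / s - 1)
          = hρ.1.eigenvalues i * (1 - Real.log s) - hρ.1.eigenvalues i ^ 2 * s⁻¹ := by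
          intro i; ring
        rw [Finset.sum_congr rfl fun i _ => h i, Finset.sum_sub_distrib, ← Finset.sum_mul,
          ← Finset.sum_mul, ← hs, ← hq, mul_inv_cancel₀ hpos.ne']
        ring
    _ ≤ _ := Finset.sum_le_sum fun i _ =>
        neg_mul_log_sub_le_negMulLog (hρ.eigenvalues_nonneg i) hpos

theorem eigenvalues_le_one (hρ : ρ.PosSemidef) (h1 : ρ.trace.re ≤ 1) (i : n) :
    hρ.1.eigenvalues i ≤ 1 := by
  rw [hρ.1.re_trace_eq_sum_eigenvalues] at h1
  exact (Finset.single_le_sum (fun j _ => hρ.eigenvalues_nonneg j) (Finset.mem_univ i)).trans h1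

theorem re_trace_mul_self_le_one (hρ : ρ.PosSemidef) (h1 : ρ.trace = 1) :
    (ρ * ρ).trace.re ≤ 1 := by
  have hs := hρ.1.re_trace_eq_sum_eigenvalues
  rw [h1, Complex.one_re] at hs
  rw [hρ.1.re_trace_mul_self, hs]
  refine Finset.sum_le_sum fun i _ => ?_
  rw [sq]
  exact mul_le_of_le_one_left (hρ.eigenvalues_nonneg i)
    (eigenvalues_le_one hρ (by simp [h1]) i)

theorem renyi2_nonneg (hρ : ρ.PosSemidef) (h1 : ρ.trace = 1) : 0 ≤ renyi2 ρ := by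
  rw [renyi2, neg_nonneg]
  exact Real.logb_nonpos one_lt_two (re_trace_mul_self_pos hρ h1).le
    (re_trace_mul_self_le_one hρ h1)

/-- A crude bound, one unit per eigenvalue, that serves only for integrability. -/
theorem abs_vnEntropy_le (hρ : ρ.PosSemidef) (h1 : ρ.trace = 1) :
    |vnEntropy ρ| ≤ Fintype.card n / Real.log 2 := by
  have hl := Real.log_pos one_lt_two
  rw [vnEntropy, abs_div, abs_of_pos hl, hρ.1.re_trace_cfc]
  refine div_le_div_of_nonneg_right ?_ hl.le
  have h0 : ∀ i, 0 ≤ Real.negMulLog (hρ.1.eigenvalues i) := fun i =>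
    Real.negMulLog_nonneg (hρ.eigenvalues_nonneg i) (eigenvalues_le_one hρ (by simp [h1]) i)
  rw [abs_of_nonneg (Finset.sum_nonneg fun i _ => h0 i)]
  calc _ ≤ ∑ _i : n, (1 : ℝ) := Finset.sum_le_sum fun i _ => by
        have hx := hρ.eigenvalues_nonneg i
        have := Real.negMulLog_le_one_sub_self hx
        linarith
    _ = _ := by simp

/-- The spectrum of an idempotent lies in {0, 1}, where x log x vanishes. -/
theorem vnEntropy_eq_zero_of_mul_self (h : ρ * ρ = ρ) :
    vnEntropy ρ = 0 := by
  have hc : cfc Real.negMulLog ρ = 0 := by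
    rw [← cfc_zero ℝ ρ]
    refine cfc_congr fun x hx => ?_
    have hid : IsIdempotentElem ρ := h
    rcases hid.spectrum_subset ℝ hx with rfl | hx
    · simp
    · rw [Set.mem_singleton_iff.1 hx]; simp
  simp [vnEntropy, hc]

theorem measurable_pow_apply {Ω : Type*} [MeasurableSpace Ω] {ρ : Ω → Matrix n n ℂ}
    (hm : ∀ i j, Measurable fun ω => ρ ω i j) (k : ℕ) (i j : n) :
    Measurable fun ω => (ρ ω ^ k) i j := by
  induction k generalizing i j with
  | zero => simp
  | succ k ih =>
    simp only [pow_succ, Matrix.mul_apply]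
    exact Finset.measurable_sum _ fun l _ => (ih i l).mul (hm l j)

/-- By Weierstrass, x log x is a uniform limit of polynomials on [0, 1], which contains the
spectrum, and traces of polynomials in ρ are measurable. Trace at most 1, rather than equal to 1,
admits the zero conditional state of an outcome of probability 0. -/
theorem measurable_vnEntropy {Ω : Type*} [MeasurableSpace Ω] {ρ : Ω → Matrix n n ℂ}
    (hm : ∀ i j, Measurable fun ω => ρ ω i j) (hρ : ∀ ω, (ρ ω).PosSemidef)
    (h1 : ∀ ω, (ρ ω).trace.re ≤ 1) : Measurable fun ω => vnEntropy (ρ ω) := by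
  refine Measurable.div_const ?_ _
  choose p hp using fun k : ℕ => exists_polynomial_near_of_continuousOn 0 1 Real.negMulLog
    Real.continuous_negMulLog.continuousOn (1 / (k + 1 : ℝ)) (by positivity)
  refine measurable_of_tendsto_metrizable
    (f := fun (k : ℕ) ω => (Polynomial.aeval (ρ ω) (p k)).trace.re) (fun k => ?_) ?_
  · simp only [Polynomial.aeval_eq_sum_range, Matrix.trace, Matrix.diag, Matrix.sum_apply,
      Complex.re_sum, Matrix.smul_apply, Complex.smul_re, smul_eq_mul]
    exact Finset.measurable_sum _ fun i _ => Finset.measurable_sum _ fun l _ =>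
      (Complex.measurable_re.comp (measurable_pow_apply hm l i i)).const_mul _
  · rw [tendsto_pi_nhds]
    intro ω
    have hh := (hρ ω).1
    have he : ∀ k, (Polynomial.aeval (ρ ω) (p k)).trace.re
        = ∑ i, (p k).eval (hh.eigenvalues i) := by
      intro k
      rw [← hh.re_trace_cfc (p k).eval, cfc_polynomial (p k) (ρ ω) hh.isSelfAdjoint]
    simp only [he, hh.re_trace_cfc]
    refine tendsto_finsetSum _ fun i _ => ?_
    rw [tendsto_iff_dist_tendsto_zero]
    refine squeeze_zero (fun _ => dist_nonneg) (fun k => ?_) tendsto_one_div_add_atTop_nhds_zero_nat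
    exact (hp k _ ⟨(hρ ω).eigenvalues_nonneg i, eigenvalues_le_one (hρ ω) (h1 ω) i⟩).le

end Entropy

/-! ### Marginals of pure bipartite states through the matrix of amplitudes. -/

section Bipartite

open scoped ComplexOrder

variable {m n : Type*}

/-- The matrix of amplitudes of a bipartite vector. -/
def amplitudeMatrix (ψ : m × n → ℂ) : Matrix m n ℂ :=
  Matrix.of fun i j => ψ (i, j)

theorem traceSnd_pureDensity [Fintype n] (ψ : m × n → ℂ) :
    traceSnd (pureDensity ψ) = amplitudeMatrix ψ * (amplitudeMatrix ψ)ᴴ := by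
  ext i j
  simp [traceSnd, pureDensity, vecMulVec_apply, Matrix.mul_apply, amplitudeMatrix]

theorem traceFst_pureDensity [Fintype m] (ψ : m × n → ℂ) :
    traceFst (pureDensity ψ) = ((amplitudeMatrix ψ)ᴴ * amplitudeMatrix ψ)ᵀ := by
  ext i j
  simp [traceFst, pureDensity, vecMulVec_apply, Matrix.mul_apply, amplitudeMatrix, mul_comm]

variable [Fintype m] [Fintype n]

theorem posSemidef_pureDensity (ψ : m → ℂ) : (pureDensity ψ).PosSemidef :=
  posSemidef_vecMulVec_self_star ψ

theorem trace_pureDensity (ψ : m → ℂ) : (pureDensity ψ).trace = ((∑ x, ‖ψ x‖ ^ 2 : ℝ) : ℂ) := by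
  simp [pureDensity, Matrix.trace, vecMulVec_apply, Complex.mul_conj, Complex.normSq_eq_norm_sq]

theorem trace_traceSnd (ρ : Matrix (m × n) (m × n) ℂ) : (traceSnd ρ).trace = ρ.trace := by
  simp [traceSnd, Matrix.trace, Fintype.sum_prod_type]

theorem trace_traceFst (ρ : Matrix (m × n) (m × n) ℂ) : (traceFst ρ).trace = ρ.trace := by
  simp [traceFst, Matrix.trace, Fintype.sum_prod_type_right]

theorem posSemidef_traceSnd_pureDensity (ψ : m × n → ℂ) :
    (traceSnd (pureDensity ψ)).PosSemidef := by
  rw [traceSnd_pureDensity]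
  exact posSemidef_self_mul_conjTranspose _

theorem posSemidef_traceFst_pureDensity (ψ : m × n → ℂ) :
    (traceFst (pureDensity ψ)).PosSemidef := by
  rw [traceFst_pureDensity]
  exact (posSemidef_conjTranspose_mul_self _).transpose

/-- With M the amplitude matrix, cyclicity gives tr (M Mᴴ)² = tr (Mᴴ M)², and transposition does not
change a trace. -/
theorem renyi2_traceSnd_pureDensity (ψ : m × n → ℂ) :
    renyi2 (traceSnd (pureDensity ψ)) = renyi2 (traceFst (pureDensity ψ)) := by
  rw [renyi2, renyi2, traceFst_pureDensity, traceSnd_pureDensity, ← Matrix.transpose_mul,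
    Matrix.trace_transpose, Matrix.mul_assoc, Matrix.trace_mul_comm, ← Matrix.mul_assoc,
    ← Matrix.mul_assoc, Matrix.mul_assoc (_ * _)]

variable [DecidableEq m] [DecidableEq n]

theorem vnEntropy_pureDensity {ψ : m → ℂ} (h : ∑ x, ‖ψ x‖ ^ 2 = 1) :
    vnEntropy (pureDensity ψ) = 0 := by
  refine vnEntropy_eq_zero_of_mul_self ?_
  have h1 : star ψ ⬝ᵥ ψ = 1 := by
    have := trace_pureDensity ψ
    rw [h, pureDensity, Matrix.trace_vecMulVec, dotProduct_comm] at this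
    simpa using this
  rw [pureDensity, Matrix.vecMulVec_mul_vecMulVec, h1, one_smul]

theorem two_mul_renyi2_le_mutualInfo {ψ : m × n → ℂ} (h : ∑ x, ‖ψ x‖ ^ 2 = 1) :
    2 * renyi2 (traceFst (pureDensity ψ)) ≤ mutualInfo (pureDensity ψ) := by
  have ht : (pureDensity ψ).trace = 1 := by rw [trace_pureDensity, h, Complex.ofReal_one]
  have h1 := renyi2_le_vnEntropy (posSemidef_traceSnd_pureDensity ψ) (by rw [trace_traceSnd, ht])
  have h2 := renyi2_le_vnEntropy (posSemidef_traceFst_pureDensity ψ) (by rw [trace_traceFst, ht])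
  rw [renyi2_traceSnd_pureDensity] at h1
  rw [mutualInfo, vnEntropy_pureDensity h]
  linarith

theorem vnEntropy_smul_one [Nonempty m] :
    vnEntropy (algebraMap ℝ (Matrix m m ℂ) (Fintype.card m : ℝ)⁻¹)
      = Real.logb 2 (Fintype.card m) := by
  have hc : (Fintype.card m : ℝ) ≠ 0 := by simp
  rw [vnEntropy, cfc_algebraMap, Real.logb]
  congr 1
  rw [Algebra.algebraMap_eq_smul_one, Matrix.trace_smul, Matrix.trace_one, Complex.smul_re]
  simp [Real.negMulLog]
  field_simp

end Bipartite

/-- The amplitude matrix is a multiple of the identity, so both marginals are maximally mixed. -/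
theorem mutualInfo_maxEntangled (NA : ℕ) :
    mutualInfo (pureDensity (maxEntangled NA)) = 2 * (NA : ℝ) := by
  have hcard : (Fintype.card (Qubits NA) : ℝ) = 2 ^ NA := by simp
  have hsq : ((1 / Real.sqrt (2 ^ NA) : ℝ) : ℂ) * ((1 / Real.sqrt (2 ^ NA) : ℝ) : ℂ)
      = (((2 : ℝ) ^ NA)⁻¹ : ℝ) := by
    rw [← Complex.ofReal_mul, div_mul_div_comm, Real.mul_self_sqrt (by positivity)]
    simp
  have hamp : amplitudeMatrix (maxEntangled NA)
      = ((1 / Real.sqrt (2 ^ NA) : ℝ) : ℂ) • (1 : Matrix (Qubits NA) (Qubits NA) ℂ) := by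
    ext i j
    simp [amplitudeMatrix, maxEntangled, Matrix.one_apply]
  have hprod : ((1 / Real.sqrt (2 ^ NA) : ℝ) : ℂ) • (1 : Matrix (Qubits NA) (Qubits NA) ℂ)
      * (((1 / Real.sqrt (2 ^ NA) : ℝ) : ℂ) • (1 : Matrix (Qubits NA) (Qubits NA) ℂ))
      = algebraMap ℝ _ (Fintype.card (Qubits NA) : ℝ)⁻¹ := by
    rw [smul_mul_smul_comm, mul_one, hsq, hcard, Algebra.algebraMap_eq_smul_one]
    ext i j
    simp [Matrix.one_apply]
  have hconj : (((1 / Real.sqrt (2 ^ NA) : ℝ) : ℂ) • (1 : Matrix (Qubits NA) (Qubits NA) ℂ))ᴴ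
      = ((1 / Real.sqrt (2 ^ NA) : ℝ) : ℂ) • (1 : Matrix (Qubits NA) (Qubits NA) ℂ) := by
    rw [Matrix.conjTranspose_smul, Matrix.conjTranspose_one, RCLike.star_def, Complex.conj_ofReal]
  have htr : (algebraMap ℝ (Matrix (Qubits NA) (Qubits NA) ℂ) (Fintype.card (Qubits NA) : ℝ)⁻¹)ᵀ
      = algebraMap ℝ _ (Fintype.card (Qubits NA) : ℝ)⁻¹ := by
    rw [Algebra.algebraMap_eq_smul_one, Matrix.transpose_smul, Matrix.transpose_one]
  have hS : traceSnd (pureDensity (maxEntangled NA))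
      = algebraMap ℝ _ (Fintype.card (Qubits NA) : ℝ)⁻¹ := by
    rw [traceSnd_pureDensity, hamp, hconj, hprod]
  have hnorm : ∑ x, ‖maxEntangled NA x‖ ^ 2 = 1 := by
    have := trace_pureDensity (maxEntangled NA)
    rw [← trace_traceSnd, hS, Algebra.algebraMap_eq_smul_one, Matrix.trace_smul,
      Matrix.trace_one] at this
    apply Complex.ofReal_injective
    rw [← this, Complex.real_smul]
    push_cast
    exact inv_mul_cancel₀ (by simp)
  rw [mutualInfo, vnEntropy_pureDensity hnorm, hS, traceFst_pureDensity, hamp, hconj, hprod, htr,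
    vnEntropy_smul_one, hcard, Real.logb_pow, Real.logb_self_eq_one one_lt_two]
  ring

/-! ### Second and fourth moments of Haar unitary entries. -/

section HaarMoments

variable {n : Type*} [Fintype n] [DecidableEq n]

instance isHaarMeasure_haarUnitary : (haarUnitary n).IsHaarMeasure :=
  inferInstanceAs (Measure.haarMeasure ⊤).IsHaarMeasure

instance isProbabilityMeasure_haarUnitary : IsProbabilityMeasure (haarUnitary n) :=
  ⟨Measure.haarMeasure_self (K₀ := (⊤ : TopologicalSpace.PositiveCompacts (unitaryGroup n ℂ)))⟩

theorem continuous_unitaryGroup_apply (a i : n) :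
    Continuous fun U : unitaryGroup n ℂ => (U : Matrix n n ℂ) a i :=
  continuous_subtype_val.matrix_elem a i

theorem Continuous.integrable_haarUnitary {f : unitaryGroup n ℂ → ℝ} (hf : Continuous f) :
    Integrable f (haarUnitary n) :=
  hf.integrable_of_hasCompactSupport (HasCompactSupport.of_compactSpace f)

theorem integral_haarUnitary_left_mul (V : unitaryGroup n ℂ) (f : Matrix n n ℂ → ℝ) :
    ∫ U, f ((V : Matrix n n ℂ) * (U : Matrix n n ℂ)) ∂(haarUnitary n)
      = ∫ U, f (U : Matrix n n ℂ) ∂(haarUnitary n) :=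
  integral_mul_left_eq_self (μ := haarUnitary n) (fun U => f (U : Matrix n n ℂ)) V

theorem integral_haarUnitary_perm (σ : Equiv.Perm n) (f : Matrix n n ℂ → ℝ) :
    ∫ U, f ((U : Matrix n n ℂ).submatrix σ id) ∂(haarUnitary n)
      = ∫ U, f (U : Matrix n n ℂ) ∂(haarUnitary n) := by
  have hV : σ.permMatrix ℂ ∈ unitaryGroup n ℂ := by
    rw [mem_unitaryGroup_iff, star_eq_conjTranspose, conjTranspose_permMatrix, ← permMatrix_mul]
    simp
  rw [← integral_haarUnitary_left_mul ⟨_, hV⟩]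
  simp only [PEquiv.toMatrix_toPEquiv_mul]

/-- The reflection along a vector of squared norm `5` is unitary. -/
theorem reflection_mem_unitaryGroup {u : n → ℂ} (hu : star u ⬝ᵥ u = 5) :
    1 - (2 / 5 : ℂ) • vecMulVec u (star u) ∈ unitaryGroup n ℂ := by
  have hs : star (vecMulVec u (star u)) = vecMulVec u (star u) := by
    rw [star_eq_conjTranspose, conjTranspose_vecMulVec, star_star]
  have hm : vecMulVec u (star u) * vecMulVec u (star u) = (5 : ℂ) • vecMulVec u (star u) := by
    rw [vecMulVec_mul_vecMulVec, hu, vecMulVec_smul]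
  have hc : star (2 / 5 : ℂ) = 2 / 5 := by simp
  rw [mem_unitaryGroup_iff, star_sub, star_one, star_smul, hs, hc, sub_mul, mul_sub, mul_sub,
    one_mul, one_mul, mul_one, smul_mul_smul_comm, hm, smul_smul]
  module

/-- `|U_{ai}|² |U_{bj}|²`. -/
noncomputable def absTerm {n : Type*} (U : Matrix n n ℂ) (a b i j : n) : ℝ :=
  ‖U a i‖ ^ 2 * ‖U b j‖ ^ 2

/-- `Re (U_{ai} \bar U_{bi} U_{bj} \bar U_{aj})`. -/
def crossTerm {n : Type*} (U : Matrix n n ℂ) (a b i j : n) : ℝ :=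
  (U a i * star (U b i) * U b j * star (U a j)).re

theorem crossTerm_self {n : Type*} (U : Matrix n n ℂ) (a i j : n) :
    crossTerm U a a i j = absTerm U a a i j := by
  simp only [crossTerm, absTerm, Complex.sq_norm, Complex.normSq_apply, RCLike.star_def,
    Complex.mul_re, Complex.mul_im, Complex.conj_re, Complex.conj_im]
  ring

theorem integrable_absTerm (a b i j : n) :
    Integrable (fun U : unitaryGroup n ℂ => absTerm (U : Matrix n n ℂ) a b i j) (haarUnitary n) :=
  Continuous.integrable_haarUnitary <|
    ((continuous_unitaryGroup_apply a i).norm.pow 2).mul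
      ((continuous_unitaryGroup_apply b j).norm.pow 2)

theorem integrable_crossTerm (a b i j : n) :
    Integrable (fun U : unitaryGroup n ℂ => crossTerm (U : Matrix n n ℂ) a b i j) (haarUnitary n) :=
  Continuous.integrable_haarUnitary <| Complex.continuous_re.comp <|
    (((continuous_unitaryGroup_apply a i).mul (continuous_unitaryGroup_apply b i).star).mul
      (continuous_unitaryGroup_apply b j)).mul (continuous_unitaryGroup_apply a j).star

theorem integrable_sq_norm_apply (a i : n) :
    Integrable (fun U : unitaryGroup n ℂ => ‖(U : Matrix n n ℂ) a i‖ ^ 2) (haarUnitary n) :=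
  Continuous.integrable_haarUnitary ((continuous_unitaryGroup_apply a i).norm.pow 2)

theorem sum_star_mul_apply (U : unitaryGroup n ℂ) (i j : n) :
    ∑ b, star ((U : Matrix n n ℂ) b i) * (U : Matrix n n ℂ) b j = if i = j then 1 else 0 := by
  have h := congrFun (congrFun (UnitaryGroup.star_mul_self U) i) j
  rwa [Matrix.mul_apply, Matrix.one_apply] at h

theorem sum_sq_norm_apply (U : unitaryGroup n ℂ) (i : n) :
    ∑ b, ‖(U : Matrix n n ℂ) b i‖ ^ 2 = 1 := by
  have h := sum_star_mul_apply U i i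
  rw [if_pos rfl] at h
  apply Complex.ofReal_injective
  rw [Complex.ofReal_one, ← h]
  push_cast
  exact Finset.sum_congr rfl fun b _ => by rw [RCLike.star_def, Complex.conj_mul']

theorem integral_sq_norm_apply (a i : n) :
    ∫ U, ‖(U : Matrix n n ℂ) a i‖ ^ 2 ∂(haarUnitary n) = 1 / Fintype.card n := by
  have hc : ∀ b, ∫ U, ‖(U : Matrix n n ℂ) b i‖ ^ 2 ∂(haarUnitary n)
      = ∫ U, ‖(U : Matrix n n ℂ) a i‖ ^ 2 ∂(haarUnitary n) := fun b => by
    have := integral_haarUnitary_perm (Equiv.swap a b) fun M => ‖M a i‖ ^ 2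
    simpa using this
  have hs : ∑ b, ∫ U, ‖(U : Matrix n n ℂ) b i‖ ^ 2 ∂(haarUnitary n) = 1 := by
    rw [← integral_finsetSum _ fun b _ => integrable_sq_norm_apply b i]
    simp [sum_sq_norm_apply]
  have : Nonempty n := ⟨a⟩
  rw [Finset.sum_congr rfl fun b _ => hc b, Finset.sum_const, Finset.card_univ,
    nsmul_eq_mul] at hs
  rw [eq_div_iff (by simp), mul_comm, hs]

theorem sum_integral_absTerm_right (a i j : n) :
    ∑ b, ∫ U, absTerm (U : Matrix n n ℂ) a b i j ∂(haarUnitary n) = 1 / Fintype.card n := by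
  rw [← integral_finsetSum _ fun b _ => integrable_absTerm a b i j, ← integral_sq_norm_apply a i]
  congr 1 with U
  simp only [absTerm, ← Finset.mul_sum, sum_sq_norm_apply, mul_one]

theorem sum_integral_absTerm_left (a i j : n) :
    ∑ b, ∫ U, absTerm (U : Matrix n n ℂ) b a i j ∂(haarUnitary n) = 1 / Fintype.card n := by
  rw [← sum_integral_absTerm_right a j i]
  simp only [absTerm, mul_comm]

/-- Summing over b produces the inner product of columns i and j. -/
theorem sum_integral_crossTerm (a i j : n) :
    ∑ b, ∫ U, crossTerm (U : Matrix n n ℂ) a b i j ∂(haarUnitary n)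
      = (if i = j then 1 else 0) / Fintype.card n := by
  rw [← integral_finsetSum _ fun b _ => integrable_crossTerm a b i j]
  have h : ∀ U : unitaryGroup n ℂ, ∑ b, crossTerm (U : Matrix n n ℂ) a b i j
      = if i = j then ‖(U : Matrix n n ℂ) a i‖ ^ 2 else 0 := by
    intro U
    simp only [crossTerm, ← Complex.re_sum, mul_assoc, ← Finset.mul_sum]
    simp only [← mul_assoc, ← Finset.sum_mul, sum_star_mul_apply]
    split_ifs with hij
    · subst hij
      rw [mul_one, RCLike.star_def, Complex.mul_conj', ← Complex.ofReal_pow, Complex.ofReal_re]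
    · simp
  simp only [h]
  split_ifs
  · exact integral_sq_norm_apply a i
  · simp

theorem integral_crossTerm_eq_of_ne {a b c : n} (hb : b ≠ a) (hc : c ≠ a) (i j : n) :
    ∫ U, crossTerm (U : Matrix n n ℂ) a b i j ∂(haarUnitary n)
      = ∫ U, crossTerm (U : Matrix n n ℂ) a c i j ∂(haarUnitary n) := by
  have := integral_haarUnitary_perm (Equiv.swap b c) fun M => crossTerm M a c i j
  simpa [crossTerm, Equiv.swap_apply_of_ne_of_ne hb.symm hc.symm] using this

theorem integral_absTerm_self_eq (a b i j : n) :
    ∫ U, absTerm (U : Matrix n n ℂ) a a i j ∂(haarUnitary n)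
      = ∫ U, absTerm (U : Matrix n n ℂ) b b i j ∂(haarUnitary n) := by
  have := integral_haarUnitary_perm (Equiv.swap a b) fun M => absTerm M b b i j
  simpa [absTerm] using this

/-- Adding the four phases 1, -1, i, -i in front of q and s cancels every term whose degrees in the
phase and in its conjugate differ. -/
theorem phase_average_sq_norm (p q r s : ℂ) :
    (‖3 / 5 * p - 4 / 5 * q‖ ^ 2 * ‖3 / 5 * r - 4 / 5 * s‖ ^ 2
      + ‖3 / 5 * p + 4 / 5 * q‖ ^ 2 * ‖3 / 5 * r + 4 / 5 * s‖ ^ 2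
      + ‖3 / 5 * p - 4 / 5 * Complex.I * q‖ ^ 2 * ‖3 / 5 * r - 4 / 5 * Complex.I * s‖ ^ 2
      + ‖3 / 5 * p + 4 / 5 * Complex.I * q‖ ^ 2 * ‖3 / 5 * r + 4 / 5 * Complex.I * s‖ ^ 2)
    = 4 * (81 / 625 * (‖p‖ ^ 2 * ‖r‖ ^ 2) + 256 / 625 * (‖q‖ ^ 2 * ‖s‖ ^ 2)
      + 144 / 625 * (‖p‖ ^ 2 * ‖s‖ ^ 2 + ‖q‖ ^ 2 * ‖r‖ ^ 2
        + 2 * (p * star q * s * star r).re)) := by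
  have h3 : (3 / 5 : ℂ) = ((3 / 5 : ℝ) : ℂ) := by norm_num
  have h4 : (4 / 5 : ℂ) = ((4 / 5 : ℝ) : ℂ) := by norm_num
  rw [h3, h4]
  simp only [Complex.sq_norm, Complex.normSq_apply, RCLike.star_def, Complex.add_re,
    Complex.add_im, Complex.sub_re, Complex.sub_im, Complex.mul_re, Complex.mul_im,
    Complex.conj_re, Complex.conj_im, Complex.ofReal_re, Complex.ofReal_im, Complex.I_re,
    Complex.I_im]
  ring

/-- Left invariance under a reflection whose row a has entries 3/5 and -4/5 θ in columns a and b. -/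
theorem integral_absTerm_rotate {a b : n} (hab : a ≠ b) (i j : n) {θ : ℂ} (hθ : star θ * θ = 1) :
    ∫ U, ‖3 / 5 * (U : Matrix n n ℂ) a i - 4 / 5 * θ * (U : Matrix n n ℂ) b i‖ ^ 2
        * ‖3 / 5 * (U : Matrix n n ℂ) a j - 4 / 5 * θ * (U : Matrix n n ℂ) b j‖ ^ 2
        ∂(haarUnitary n)
      = ∫ U, absTerm (U : Matrix n n ℂ) a a i j ∂(haarUnitary n) := by
  -- The ratio 1 : 2 gives squared norm 5, so the reflection has the rational coefficients 1 - 2/5 =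
  -- 3/5 and -(2/5)·2 = -4/5.
  set u : n → ℂ := Pi.single a 1 + Pi.single b (2 * star θ) with hu
  have hua : u a = 1 := by simp [hu, hab]
  have hdot : ∀ v : n → ℂ, star u ⬝ᵥ v = v a + 2 * θ * v b := by
    intro v
    have : star u = Pi.single a 1 + Pi.single b (2 * θ) := by
      rw [hu, star_add, Pi.star_single, Pi.star_single]
      simp
    rw [this, add_dotProduct, single_dotProduct, single_dotProduct, one_mul]
  have hub : u b = 2 * star θ := by simp [hu, hab.symm]
  have hu5 : star u ⬝ᵥ u = 5 := by
    rw [hdot, hua, hub]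
    linear_combination 4 * hθ
  rw [← integral_haarUnitary_left_mul ⟨_, reflection_mem_unitaryGroup hu5⟩
    fun M => absTerm M a a i j]
  have key : ∀ (M : Matrix n n ℂ) (l : n), ((1 - (2 / 5 : ℂ) • vecMulVec u (star u)) * M) a l
      = 3 / 5 * M a l - 4 / 5 * θ * M b l := by
    intro M l
    have h := hdot fun k => M k l
    rw [sub_mul, one_mul, Matrix.smul_mul, vecMulVec_mul, Matrix.sub_apply, Matrix.smul_apply,
      vecMulVec_apply, hua, smul_eq_mul, one_mul]
    change M a l - 2 / 5 * (star u ⬝ᵥ fun k => M k l) = _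
    rw [h]
    ring
  simp only [absTerm, key]

/-- Averaging the rotated identity over four phases gives a linear relation between moments: (1 -
81/625 - 256/625) = 288/625 on one side against 144/625 on the other. -/
theorem two_mul_integral_absTerm_self {a b : n} (hab : a ≠ b) (i j : n) :
    2 * ∫ U, absTerm (U : Matrix n n ℂ) a a i j ∂(haarUnitary n)
      = ∫ U, absTerm (U : Matrix n n ℂ) a b i j ∂(haarUnitary n)
        + ∫ U, absTerm (U : Matrix n n ℂ) b a i j ∂(haarUnitary n)
        + 2 * ∫ U, crossTerm (U : Matrix n n ℂ) a b i j ∂(haarUnitary n) := by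
  have hrot := fun (θ : ℂ) (hθ : star θ * θ = 1) => integral_absTerm_rotate hab i j hθ
  have hint : ∀ θ : ℂ, Integrable (fun U : unitaryGroup n ℂ =>
      ‖3 / 5 * (U : Matrix n n ℂ) a i - 4 / 5 * θ * (U : Matrix n n ℂ) b i‖ ^ 2
        * ‖3 / 5 * (U : Matrix n n ℂ) a j - 4 / 5 * θ * (U : Matrix n n ℂ) b j‖ ^ 2)
      (haarUnitary n) := by
    intro θ
    have h1 := continuous_unitaryGroup_apply a i
    have h2 := continuous_unitaryGroup_apply b i
    have h3 := continuous_unitaryGroup_apply a j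
    have h4 := continuous_unitaryGroup_apply b j
    exact Continuous.integrable_haarUnitary <|
      (((h1.const_mul _).sub (h2.const_mul _)).norm.pow 2).mul
        (((h3.const_mul _).sub (h4.const_mul _)).norm.pow 2)
  have hx := integral_absTerm_self_eq a b i j
  have hsum : ∫ U, 4 * (81 / 625 * absTerm (U : Matrix n n ℂ) a a i j
      + 256 / 625 * absTerm (U : Matrix n n ℂ) b b i j
      + 144 / 625 * (absTerm (U : Matrix n n ℂ) a b i j + absTerm (U : Matrix n n ℂ) b a i j
        + 2 * crossTerm (U : Matrix n n ℂ) a b i j)) ∂(haarUnitary n)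
      = 4 * ∫ U, absTerm (U : Matrix n n ℂ) a a i j ∂(haarUnitary n) := by
    have s2 := integral_add (hint 1) (hint (-1))
    have s3 := integral_add ((hint 1).add (hint (-1))) (hint Complex.I)
    have s4 := integral_add (((hint 1).add (hint (-1))).add (hint Complex.I)) (hint (-Complex.I))
    simp only [Pi.add_apply] at s3 s4
    rw [s3, s2, hrot 1 (by simp), hrot (-1) (by simp), hrot Complex.I (by simp),
      hrot (-Complex.I) (by simp)] at s4
    trans
    · refine Eq.trans ?_ s4
      congr 1 with U
      have := phase_average_sq_norm ((U : Matrix n n ℂ) a i) ((U : Matrix n n ℂ) b i)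
        ((U : Matrix n n ℂ) a j) ((U : Matrix n n ℂ) b j)
      simp only [absTerm, crossTerm]
      rw [← this]
      simp only [mul_one, mul_neg, neg_mul, sub_neg_eq_add]
    · ring
  have e1 := integrable_absTerm (n := n) a a i j
  have e2 := integrable_absTerm (n := n) b b i j
  have e3 := integrable_absTerm (n := n) a b i j
  have e4 := integrable_absTerm (n := n) b a i j
  have e5 := integrable_crossTerm (n := n) a b i j
  have s1 := integral_add ((e1.const_mul (81 / 625)).add (e2.const_mul (256 / 625)))
    (((e3.add e4).add (e5.const_mul 2)).const_mul (144 / 625))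
  have s2 := integral_add (e1.const_mul (81 / 625)) (e2.const_mul (256 / 625))
  have s3 := integral_add (e3.add e4) (e5.const_mul 2)
  have s4 := integral_add e3 e4
  simp only [Pi.add_apply, integral_const_mul] at s1 s2 s3 s4 hsum
  rw [s1, s2, s3, s4] at hsum
  linarith

/-- `E |U_{ai}|² |U_{aj}|² = (1 + δ_{ij}) / (d (d + 1))`. -/
theorem integral_crossTerm_self (a i j : n) :
    ∫ U, crossTerm (U : Matrix n n ℂ) a a i j ∂(haarUnitary n)
      = (1 + if i = j then 1 else 0) / (Fintype.card n * (Fintype.card n + 1)) := by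
  -- At b = a the right side is four times the diagonal moment; the conditional term supplies the
  -- missing two, so the relation can be summed over all b.
  have h : ∀ b, (2 * ∫ U, absTerm (U : Matrix n n ℂ) a a i j ∂(haarUnitary n))
      + (if a = b then 2 * ∫ U, absTerm (U : Matrix n n ℂ) a a i j ∂(haarUnitary n) else 0)
      = ∫ U, absTerm (U : Matrix n n ℂ) a b i j ∂(haarUnitary n)
        + ∫ U, absTerm (U : Matrix n n ℂ) b a i j ∂(haarUnitary n)
        + 2 * ∫ U, crossTerm (U : Matrix n n ℂ) a b i j ∂(haarUnitary n) := by
    intro b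
    split_ifs with hab
    · subst hab
      simp only [crossTerm_self]
      ring
    · rw [add_zero, two_mul_integral_absTerm_self hab]
  have hs := Finset.sum_congr (rfl : (Finset.univ : Finset n) = _) fun b _ => h b
  rw [Finset.sum_add_distrib, Finset.sum_add_distrib, Finset.sum_add_distrib, ← Finset.mul_sum, ← Finset.mul_sum,
    sum_integral_absTerm_right, sum_integral_absTerm_left, sum_integral_crossTerm,
    Finset.sum_const, Finset.card_univ, nsmul_eq_mul, Finset.sum_ite_eq,
    if_pos (Finset.mem_univ a)] at hs
  simp only [crossTerm_self]
  have : Nonempty n := ⟨a⟩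
  have hd : (Fintype.card n : ℝ) ≠ 0 := by simp
  have hd1 : (Fintype.card n : ℝ) + 1 ≠ 0 := by positivity
  field_simp at hs ⊢
  linarith

/-- By row permutations the d - 1 terms with b ≠ a are equal, so they share what remains of the
column sum after the diagonal term. Keeping the factor d - 1 avoids a division. -/
theorem card_sub_one_mul_integral_crossTerm {a b : n} (hb : b ≠ a) (i j : n) :
    ((Fintype.card n : ℝ) - 1) * ∫ U, crossTerm (U : Matrix n n ℂ) a b i j ∂(haarUnitary n)
      = (if i = j then 1 else 0) / Fintype.card n
        - (1 + if i = j then 1 else 0) / (Fintype.card n * (Fintype.card n + 1)) := by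
  rw [← sum_integral_crossTerm a i j, ← integral_crossTerm_self a i j,
    ← Finset.sum_erase_eq_sub (Finset.mem_univ a),
    Finset.sum_congr rfl fun c hc =>
      integral_crossTerm_eq_of_ne (Finset.ne_of_mem_erase hc) hb i j,
    Finset.sum_const, Finset.card_erase_of_mem (Finset.mem_univ a), Finset.card_univ,
    nsmul_eq_mul, Nat.cast_sub (Fintype.card_pos_iff.2 ⟨a⟩), Nat.cast_one]

end HaarMoments

/-! ### Outcome probabilities, conditional states and integrability. -/

section Measurement

variable {NA NB : ℕ}

theorem outputState_apply (U : unitaryGroup (Qubits NA × Qubits NB) ℂ) (r : Qubits NA)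
    (x : Qubits NA × Qubits NB) :
    outputState U (r, x)
      = ((1 / Real.sqrt (2 ^ NA) : ℝ) : ℂ) * U.1 x (r, 0) := by
  simp only [outputState, mulVec, dotProduct, Fintype.sum_prod_type, kroneckerMap_apply,
    one_apply, inputState, maxEntangled, zeroState]
  rw [Finset.sum_eq_single r (fun b _ hb => by simp [hb.symm]) (by simp),
    Finset.sum_eq_single r (fun b _ hb => by simp [hb.symm]) (by simp),
    Finset.sum_eq_single 0 (fun b _ hb => by simp [hb]) (by simp)]
  simp [mul_comm]

theorem projectedState_apply (U : unitaryGroup (Qubits NA × Qubits NB) ℂ) (z : Qubits NB)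
    (r a : Qubits NA) :
    projectedState U z (r, a)
      = ((1 / Real.sqrt (2 ^ NA) : ℝ) : ℂ) * U.1 (a, z) (r, 0) :=
  outputState_apply U r (a, z)

theorem outcomeProb_eq (U : unitaryGroup (Qubits NA × Qubits NB) ℂ) (z : Qubits NB) :
    outcomeProb U z = (2 ^ NA)⁻¹ * ∑ r, ∑ a, ‖U.1 (a, z) (r, 0)‖ ^ 2 := by
  simp only [outcomeProb, Fintype.sum_prod_type, projectedState_apply, norm_mul, mul_pow,
    Complex.norm_real, Real.norm_eq_abs, sq_abs, div_pow, one_pow, Finset.mul_sum]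
  rw [Real.sq_sqrt (by positivity), one_div]

theorem outcomeProb_nonneg (U : unitaryGroup (Qubits NA × Qubits NB) ℂ) (z : Qubits NB) :
    0 ≤ outcomeProb U z :=
  Finset.sum_nonneg fun _ _ => sq_nonneg _

theorem sum_outcomeProb (U : unitaryGroup (Qubits NA × Qubits NB) ℂ) :
    ∑ z, outcomeProb U z = 1 := by
  simp only [outcomeProb_eq, ← Finset.mul_sum]
  rw [Finset.sum_comm]
  have h : ∀ r : Qubits NA, ∑ z : Qubits NB, ∑ a, ‖U.1 (a, z) (r, 0)‖ ^ 2 = 1 := by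
    intro r
    rw [← sum_sq_norm_apply U (r, 0), Fintype.sum_prod_type_right]
  simp [h]

theorem outcomeProb_le_one (U : unitaryGroup (Qubits NA × Qubits NB) ℂ) (z : Qubits NB) :
    outcomeProb U z ≤ 1 := by
  rw [← sum_outcomeProb U]
  exact Finset.single_le_sum (fun z _ => outcomeProb_nonneg U z) (Finset.mem_univ z)

theorem continuous_projectedState (z : Qubits NB) (x : Qubits NA × Qubits NA) :
    Continuous fun U : unitaryGroup (Qubits NA × Qubits NB) ℂ => projectedState U z x := by
  obtain ⟨r, a⟩ := x
  simp only [projectedState_apply]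
  exact (continuous_unitaryGroup_apply _ _).const_mul _

theorem continuous_outcomeProb (z : Qubits NB) :
    Continuous fun U : unitaryGroup (Qubits NA × Qubits NB) ℂ => outcomeProb U z :=
  continuous_finsetSum _ fun x _ => (continuous_projectedState z x).norm.pow 2

theorem measurable_conditionalState (z : Qubits NB) (x : Qubits NA × Qubits NA) :
    Measurable fun U : unitaryGroup (Qubits NA × Qubits NB) ℂ => conditionalState U z x :=
  (continuous_projectedState z x).measurable.div
    (Complex.measurable_ofReal.comp (continuous_outcomeProb z).measurable.sqrt)

theorem sum_sq_norm_conditionalState (U : unitaryGroup (Qubits NA × Qubits NB) ℂ)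
    (z : Qubits NB) :
    ∑ x, ‖conditionalState U z x‖ ^ 2 = outcomeProb U z / outcomeProb U z := by
  simp only [conditionalState, norm_div, div_pow, Complex.norm_real, Real.norm_eq_abs, sq_abs,
    Real.sq_sqrt (outcomeProb_nonneg U z), ← Finset.sum_div]
  rfl

theorem sum_sq_norm_conditionalState_eq_one {U : unitaryGroup (Qubits NA × Qubits NB) ℂ}
    {z : Qubits NB} (h : outcomeProb U z ≠ 0) : ∑ x, ‖conditionalState U z x‖ ^ 2 = 1 := by
  rw [sum_sq_norm_conditionalState, div_self h]

theorem avgTwiceRenyi2_le_avgMutualInfo (U : unitaryGroup (Qubits NA × Qubits NB) ℂ) :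
    avgTwiceRenyi2 U ≤ avgMutualInfo U := by
  refine Finset.sum_le_sum fun z _ => ?_
  by_cases h : outcomeProb U z = 0
  · simp [h]
  · exact mul_le_mul_of_nonneg_left
      (two_mul_renyi2_le_mutualInfo (sum_sq_norm_conditionalState_eq_one h))
      (outcomeProb_nonneg U z)

theorem avgTwiceRenyi2_nonneg (U : unitaryGroup (Qubits NA × Qubits NB) ℂ) :
    0 ≤ avgTwiceRenyi2 U := by
  refine Finset.sum_nonneg fun z _ => ?_
  by_cases h : outcomeProb U z = 0
  · simp [h]
  · refine mul_nonneg (outcomeProb_nonneg U z) (mul_nonneg two_pos.le (renyi2_nonneg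
      (posSemidef_traceFst_pureDensity _) ?_))
    rw [trace_traceFst, trace_pureDensity, sum_sq_norm_conditionalState_eq_one h,
      Complex.ofReal_one]

theorem measurable_pureDensity_conditionalState (z : Qubits NB) (x y : Qubits NA × Qubits NA) :
    Measurable fun U : unitaryGroup (Qubits NA × Qubits NB) ℂ =>
      pureDensity (conditionalState U z) x y := by
  simp only [pureDensity, vecMulVec_apply, Pi.star_apply]
  exact (measurable_conditionalState z x).mul (continuous_star.measurable.comp
    (measurable_conditionalState z y))

/-- The trace is P/P, which is 1, or 0 when P = 0 by the convention for division by zero. -/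
theorem re_trace_pureDensity_conditionalState_le (U : unitaryGroup (Qubits NA × Qubits NB) ℂ)
    (z : Qubits NB) : (pureDensity (conditionalState U z)).trace.re ≤ 1 := by
  rw [trace_pureDensity, Complex.ofReal_re, sum_sq_norm_conditionalState]
  exact div_self_le_one _

theorem measurable_traceFst_conditionalState (z : Qubits NB) (i j : Qubits NA) :
    Measurable fun U : unitaryGroup (Qubits NA × Qubits NB) ℂ =>
      traceFst (pureDensity (conditionalState U z)) i j := by
  simp only [traceFst, of_apply]
  exact Finset.measurable_sum _ fun k _ => measurable_pureDensity_conditionalState z _ _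

theorem measurable_traceSnd_conditionalState (z : Qubits NB) (i j : Qubits NA) :
    Measurable fun U : unitaryGroup (Qubits NA × Qubits NB) ℂ =>
      traceSnd (pureDensity (conditionalState U z)) i j := by
  simp only [traceSnd, of_apply]
  exact Finset.measurable_sum _ fun k _ => measurable_pureDensity_conditionalState z _ _

theorem measurable_mutualInfo_conditionalState (z : Qubits NB) :
    Measurable fun U : unitaryGroup (Qubits NA × Qubits NB) ℂ =>
      mutualInfo (pureDensity (conditionalState U z)) := by
  refine ((measurable_vnEntropy (measurable_traceSnd_conditionalState z)
    (fun U => posSemidef_traceSnd_pureDensity _) fun U => ?_).add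
    (measurable_vnEntropy (measurable_traceFst_conditionalState z)
    (fun U => posSemidef_traceFst_pureDensity _) fun U => ?_)).sub
    (measurable_vnEntropy (measurable_pureDensity_conditionalState z)
    (fun U => posSemidef_pureDensity _) fun U => re_trace_pureDensity_conditionalState_le U z)
  · rw [trace_traceSnd]
    exact re_trace_pureDensity_conditionalState_le U z
  · rw [trace_traceFst]
    exact re_trace_pureDensity_conditionalState_le U z

theorem abs_mutualInfo_pureDensity_le {m n : Type*} [Fintype m] [DecidableEq m] [Fintype n]
    [DecidableEq n] {ψ : m × n → ℂ} (h : ∑ x, ‖ψ x‖ ^ 2 = 1) :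
    |mutualInfo (pureDensity ψ)|
      ≤ Fintype.card m / Real.log 2 + Fintype.card n / Real.log 2 := by
  have ht : (pureDensity ψ).trace = 1 := by rw [trace_pureDensity, h, Complex.ofReal_one]
  rw [mutualInfo, vnEntropy_pureDensity h, sub_zero]
  exact (abs_add_le _ _).trans (add_le_add
    (abs_vnEntropy_le (posSemidef_traceSnd_pureDensity ψ) (by rw [trace_traceSnd, ht]))
    (abs_vnEntropy_le (posSemidef_traceFst_pureDensity ψ) (by rw [trace_traceFst, ht])))

theorem integrable_avgMutualInfo (NA NB : ℕ) :
    Integrable (fun U => avgMutualInfo U) (haarUnitary (Qubits NA × Qubits NB)) := by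
  refine integrable_finsetSum _ fun z _ => ?_
  refine Integrable.of_bound
    ((continuous_outcomeProb z).measurable.mul
      (measurable_mutualInfo_conditionalState z)).aestronglyMeasurable
    (Fintype.card (Qubits NA) / Real.log 2 + Fintype.card (Qubits NA) / Real.log 2)
    (Eventually.of_forall fun U => ?_)
  have hl := Real.log_pos one_lt_two
  by_cases h : outcomeProb U z = 0
  · rw [h, zero_mul, norm_zero]
    positivity
  · rw [Real.norm_eq_abs, abs_mul, abs_of_nonneg (outcomeProb_nonneg U z)]
    exact (mul_le_of_le_one_left (abs_nonneg _) (outcomeProb_le_one U z)).trans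
      (abs_mutualInfo_pureDensity_le (sum_sq_norm_conditionalState_eq_one h))

/-- Domination by the averaged mutual information, since 0 ≤ 2 S₂ ≤ I after averaging over outcomes.
-/
theorem integrable_avgTwiceRenyi2 (NA NB : ℕ) :
    Integrable (fun U => avgTwiceRenyi2 U) (haarUnitary (Qubits NA × Qubits NB)) := by
  refine (integrable_avgMutualInfo NA NB).mono' ?_ (Eventually.of_forall fun U => ?_)
  · exact (Finset.measurable_sum _ fun z _ => (continuous_outcomeProb z).measurable.mul
      ((measurable_renyi2 (measurable_traceFst_conditionalState z)).const_mul
        2)).aestronglyMeasurable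
  · rw [Real.norm_eq_abs, abs_of_nonneg (avgTwiceRenyi2_nonneg U)]
    exact avgTwiceRenyi2_le_avgMutualInfo U

end Measurement

/-! ### Averaged purity and the lower bound on the averaged Rényi entropy. -/

section HaarAverage

variable {NA NB : ℕ}

/-- The purity `tr σ²` of the unnormalized reduced state `σ` of the output system. -/
noncomputable def projectedPurity (U : unitaryGroup (Qubits NA × Qubits NB) ℂ)
    (z : Qubits NB) : ℝ :=
  (traceFst (pureDensity (projectedState U z))
    * traceFst (pureDensity (projectedState U z))).trace.re

theorem projectedPurity_eq (U : unitaryGroup (Qubits NA × Qubits NB) ℂ) (z : Qubits NB) :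
    projectedPurity U z = ((2 ^ NA) ^ 2)⁻¹ *
      ∑ a, ∑ b, ∑ i, ∑ j, crossTerm U.1 (a, z) (b, z) (i, 0) (j, 0) := by
  have hs : ((1 / Real.sqrt (2 ^ NA) : ℝ) : ℂ) ^ 4 = ((((2 : ℝ) ^ NA) ^ 2)⁻¹ : ℝ) := by
    rw [← Complex.ofReal_pow, show (4 : ℕ) = 2 * 2 from rfl, pow_mul, div_pow,
      Real.sq_sqrt (by positivity)]
    simp
  simp only [projectedPurity, Matrix.trace, diag, Matrix.mul_apply, traceFst, pureDensity,
    of_apply, vecMulVec_apply, Pi.star_apply, projectedState_apply, Finset.sum_mul_sum,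
    crossTerm, Complex.re_sum]
  simp only [Finset.mul_sum]
  refine Finset.sum_congr rfl fun a _ => Finset.sum_congr rfl fun b _ =>
    Finset.sum_congr rfl fun i _ => Finset.sum_congr rfl fun j _ => ?_
  rw [← Complex.re_ofReal_mul, ← hs]
  congr 1
  simp only [star_mul', RCLike.star_def, Complex.conj_ofReal]
  ring

theorem re_trace_mul_self_conditionalState (U : unitaryGroup (Qubits NA × Qubits NB) ℂ)
    (z : Qubits NB) :
    (traceFst (pureDensity (conditionalState U z))
      * traceFst (pureDensity (conditionalState U z))).trace.re
      = projectedPurity U z / outcomeProb U z ^ 2 := by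
  have hp : traceFst (pureDensity (conditionalState U z))
      = (((outcomeProb U z)⁻¹ : ℝ) : ℂ) • traceFst (pureDensity (projectedState U z)) := by
    ext i j
    simp only [traceFst, pureDensity, vecMulVec_apply, of_apply, conditionalState,
      Matrix.smul_apply, smul_eq_mul, Finset.mul_sum, Pi.star_apply]
    refine Finset.sum_congr rfl fun k _ => ?_
    rw [star_div₀, RCLike.star_def, Complex.conj_ofReal, div_mul_div_comm,
      ← Complex.ofReal_mul, Real.mul_self_sqrt (outcomeProb_nonneg U z), Complex.ofReal_inv,
      div_eq_inv_mul]
  rw [hp, smul_mul_smul_comm, Matrix.trace_smul, ← Complex.ofReal_mul, smul_eq_mul,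
    Complex.re_ofReal_mul, projectedPurity]
  field_simp

theorem projectedPurity_nonneg (U : unitaryGroup (Qubits NA × Qubits NB) ℂ) (z : Qubits NB) :
    0 ≤ projectedPurity U z := by
  rw [projectedPurity, (posSemidef_traceFst_pureDensity _).1.re_trace_mul_self]
  exact Finset.sum_nonneg fun _ _ => sq_nonneg _

/-- A lower bound for the weighted Rényi entropy of an outcome that is affine in the probability
and in the unnormalized purity. -/
theorem affine_le_outcomeProb_mul_renyi2 (U : unitaryGroup (Qubits NA × Qubits NB) ℂ)
    (z : Qubits NB) {p q : ℝ} (hp : 0 < p) (hq : 0 < q) :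
    ((2 - Real.log (q / p ^ 2)) * outcomeProb U z - p / q * projectedPurity U z - p) / Real.log 2
      ≤ outcomeProb U z * renyi2 (traceFst (pureDensity (conditionalState U z))) := by
  have hl := Real.log_pos one_lt_two
  have hQ0 := projectedPurity_nonneg U z
  rw [div_le_iff₀ hl]
  by_cases h : outcomeProb U z = 0
  · rw [h, mul_zero, zero_mul, zero_mul]
    have : 0 ≤ p / q * projectedPurity U z := by positivity
    linarith
  have hP : 0 < outcomeProb U z := lt_of_le_of_ne (outcomeProb_nonneg U z) (Ne.symm h)
  have hr := re_trace_mul_self_pos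
    (posSemidef_traceFst_pureDensity (conditionalState U z)) (by
      rw [trace_traceFst, trace_pureDensity, sum_sq_norm_conditionalState_eq_one h,
        Complex.ofReal_one])
  rw [renyi2, re_trace_mul_self_conditionalState, Real.logb]
  rw [re_trace_mul_self_conditionalState] at hr
  have hQ : 0 < projectedPurity U z := (div_pos_iff_of_pos_right (pow_pos hP 2)).1 hr
  generalize outcomeProb U z = P at *
  generalize projectedPurity U z = Q at *
  -- P·S₂ splits into a perspective part P log(P/Q) and a part P log P. Both instances of log x ≤ x
  -- - 1 are equalities at (P, Q) = (p, q), so their sum is the tangent plane there.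
  have h1 := Real.log_le_sub_one_of_pos (show 0 < Q * p / (q * P) by positivity)
  have h2 := Real.log_le_sub_one_of_pos (show 0 < p / P by positivity)
  rw [Real.log_div (by positivity) (by positivity), Real.log_mul hQ.ne' hp.ne',
    Real.log_mul hq.ne' hP.ne'] at h1
  rw [Real.log_div hp.ne' hP.ne'] at h2
  rw [Real.log_div hq.ne' (by positivity), Real.log_div hQ.ne' (by positivity), Real.log_pow,
    Real.log_pow]
  push_cast
  have h3 := mul_le_mul_of_nonneg_left (add_le_add h1 h2) hP.le
  have e1 : P * (Q * p / (q * P) - 1 + (p / P - 1)) = p / q * Q + p - 2 * P := by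
    field_simp
    ring
  rw [e1] at h3
  have e2 : P * -((Real.log Q - 2 * Real.log P) / Real.log 2) * Real.log 2
      = -P * (Real.log Q - 2 * Real.log P) := by
    field_simp
  rw [e2]
  linarith

theorem integral_outcomeProb (z : Qubits NB) :
    ∫ U, outcomeProb U z ∂(haarUnitary (Qubits NA × Qubits NB)) = ((2 : ℝ) ^ NB)⁻¹ := by
  simp only [outcomeProb_eq]
  rw [integral_const_mul, integral_finsetSum _ fun r _ =>
    integrable_finsetSum _ fun a _ => integrable_sq_norm_apply (a, z) (r, 0)]
  simp only [integral_finsetSum _ fun (a : Qubits NA) (_ : a ∈ Finset.univ) =>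
    integrable_sq_norm_apply (a, z) ((_ : Qubits NA), (0 : Qubits NB)), integral_sq_norm_apply]
  simp
  field_simp

theorem integrable_projectedPurity (z : Qubits NB) :
    Integrable (fun U => projectedPurity U z) (haarUnitary (Qubits NA × Qubits NB)) := by
  simp only [projectedPurity_eq]
  exact (integrable_finsetSum _ fun a _ => integrable_finsetSum _ fun b _ =>
    integrable_finsetSum _ fun i _ => integrable_finsetSum _ fun j _ =>
      integrable_crossTerm _ _ _ _).const_mul _

/-- With n = d_A and k = d_B, the exact mean for nk > 1 is (2n²k - n² - 1)/(nk(n²k² - 1)); clearing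
denominators against the bound leaves a nonnegative multiple of (k - 1)². -/
theorem integral_projectedPurity_le (z : Qubits NB) :
    ∫ U, projectedPurity U z ∂(haarUnitary (Qubits NA × Qubits NB))
      ≤ (2 - 1 / (2 : ℝ) ^ NB) / (2 ^ NA * (2 ^ NB) ^ 2) := by
  have hsum : ∀ x y : ℝ, ∑ i : Qubits NA, ∑ j : Qubits NA,
      (x + y * if ((i, 0) : Qubits NA × Qubits NB) = (j, 0) then 1 else 0)
      = (2 ^ NA) ^ 2 * x + 2 ^ NA * y := by
    intro x y
    simp [Finset.sum_add_distrib]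
    ring
  set n : ℝ := 2 ^ NA with hn
  set k : ℝ := 2 ^ NB with hk
  have hn1 : 1 ≤ n := one_le_pow₀ one_le_two
  have hk1 : 1 ≤ k := one_le_pow₀ one_le_two
  have hcard : (Fintype.card (Qubits NA × Qubits NB) : ℝ) = n * k := by simp [hn, hk]
  have hself : ∀ a : Qubits NA, ∑ i : Qubits NA, ∑ j : Qubits NA,
      ∫ U, crossTerm U.1 (a, z) (a, z) (i, 0) (j, 0) ∂(haarUnitary (Qubits NA × Qubits NB))
      = (n + 1) / (k * (n * k + 1)) := by
    intro a
    have e : ∀ t : ℝ, (1 + t) / (n * k * (n * k + 1))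
        = 1 / (n * k * (n * k + 1)) + 1 / (n * k * (n * k + 1)) * t := fun t => by ring
    simp only [integral_crossTerm_self, hcard, e, hsum]
    field_simp
  have hne : ∀ a b : Qubits NA, b ≠ a → ∑ i : Qubits NA, ∑ j : Qubits NA,
      ∫ U, crossTerm U.1 (a, z) (b, z) (i, 0) (j, 0) ∂(haarUnitary (Qubits NA × Qubits NB))
      = n * (k - 1) / (k * (n * k + 1)) / (n * k - 1) := by
    intro a b hab
    -- Two distinct labels force at least one qubit, hence nk ≥ 2 and nk - 1 may be divided by.
    have hNA : NA ≠ 0 := by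
      rintro rfl
      exact hab (Subsingleton.elim _ _)
    have hn2 : 2 ≤ n := le_self_pow₀ one_le_two hNA
    have hd : 0 < n * k - 1 := by nlinarith
    have e : ∀ t : ℝ, t / (n * k) - (1 + t) / (n * k * (n * k + 1))
        = -1 / (n * k * (n * k + 1)) + (1 / (n * k) - 1 / (n * k * (n * k + 1))) * t :=
      fun t => by ring
    have hpair : ((b, z) : Qubits NA × Qubits NB) ≠ (a, z) := fun h => hab (congrArg Prod.fst h)
    have hc := card_sub_one_mul_integral_crossTerm hpair
    simp only [hcard, e] at hc
    rw [eq_div_iff hd.ne', mul_comm]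
    simp only [Finset.mul_sum, hc, hsum]
    field_simp
    ring
  have htotal : ∫ U, projectedPurity U z ∂(haarUnitary (Qubits NA × Qubits NB))
      = (n ^ 2)⁻¹ * ∑ a, ∑ b, ∑ i, ∑ j,
        ∫ U, crossTerm U.1 (a, z) (b, z) (i, 0) (j, 0)
          ∂(haarUnitary (Qubits NA × Qubits NB)) := by
    simp only [projectedPurity_eq]
    rw [integral_const_mul, integral_finsetSum _ fun a _ => integrable_finsetSum _ fun b _ =>
      integrable_finsetSum _ fun i _ => integrable_finsetSum _ fun j _ =>
        integrable_crossTerm _ _ _ _]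
    congr 1
    refine Finset.sum_congr rfl fun a _ => ?_
    rw [integral_finsetSum _ fun b _ => integrable_finsetSum _ fun i _ =>
      integrable_finsetSum _ fun j _ => integrable_crossTerm _ _ _ _]
    refine Finset.sum_congr rfl fun b _ => ?_
    rw [integral_finsetSum _ fun i _ => integrable_finsetSum _ fun j _ =>
      integrable_crossTerm _ _ _ _]
    refine Finset.sum_congr rfl fun i _ => ?_
    rw [integral_finsetSum _ fun j _ => integrable_crossTerm _ _ _ _]
  have hrow : ∀ a : Qubits NA, ∑ b, ∑ i, ∑ j,
      ∫ U, crossTerm U.1 (a, z) (b, z) (i, 0) (j, 0) ∂(haarUnitary (Qubits NA × Qubits NB))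
      = (n + 1) / (k * (n * k + 1))
        + (n - 1) * (n * (k - 1) / (k * (n * k + 1)) / (n * k - 1)) := by
    intro a
    rw [← Finset.add_sum_erase _ _ (Finset.mem_univ a), hself,
      Finset.sum_congr rfl fun b hb => hne a b (Finset.ne_of_mem_erase hb), Finset.sum_const,
      Finset.card_erase_of_mem (Finset.mem_univ a), Finset.card_univ, nsmul_eq_mul,
      Nat.cast_sub (Fintype.card_pos_iff.2 ⟨a⟩)]
    simp [hn]
  rw [htotal]
  simp only [hrow]
  rw [Finset.sum_const, Finset.card_univ, nsmul_eq_mul,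
    show (Fintype.card (Qubits NA) : ℝ) = n by simp [hn]]
  -- For nk = 1 the closed form divides by zero; there the off-diagonal terms carry the factor n - 1
  -- = 0 and both sides equal 1.
  rcases (one_le_mul_of_one_le_of_one_le hn1 hk1).eq_or_lt with h1 | h1
  · have hn' : n = 1 := by nlinarith
    have hk' : k = 1 := by nlinarith
    rw [hn', hk']
    norm_num
  · have hd : 0 < n * k - 1 := by linarith
    have e : (n ^ 2)⁻¹ * (n * ((n + 1) / (k * (n * k + 1))
        + (n - 1) * (n * (k - 1) / (k * (n * k + 1)) / (n * k - 1))))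
        = (2 * n ^ 2 * k - n ^ 2 - 1) / (n * k * ((n * k + 1) * (n * k - 1))) := by
      field_simp
      ring
    have e' : (2 - 1 / k) / (n * k ^ 2) = (2 * k - 1) / (n * k ^ 3) := by
      field_simp
    rw [e, e', div_le_div_iff₀ (by positivity) (by positivity)]
    have : 0 ≤ n * k * (k - 1) ^ 2 := by positivity
    linarith

/-- Integrating the tangent plane at (p, q) outcome by outcome; the 1/p = d_B equal contributions
add up to -2 log₂(q/p²). -/
theorem le_integral_avgTwiceRenyi2 (NA NB : ℕ) :
    2 * ((NA : ℝ) - 1) - 2 * Real.logb 2 (1 - 1 / (2 * (2 : ℝ) ^ NB))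
      ≤ ∫ U, avgTwiceRenyi2 U ∂(haarUnitary (Qubits NA × Qubits NB)) := by
  have hl := Real.log_pos one_lt_two
  have hk : (1 : ℝ) ≤ 2 ^ NB := one_le_pow₀ one_le_two
  have hn : (0 : ℝ) < 2 ^ NA := by positivity
  have hki : 1 / (2 : ℝ) ^ NB ≤ 1 := by rw [div_le_one (by positivity)]; exact hk
  set p : ℝ := ((2 : ℝ) ^ NB)⁻¹ with hp
  set q : ℝ := (2 - 1 / (2 : ℝ) ^ NB) / (2 ^ NA * (2 ^ NB) ^ 2) with hq
  have hp0 : 0 < p := by positivity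
  have hq0 : 0 < q := div_pos (by linarith) (by positivity)
  have hint : ∀ z : Qubits NB, Integrable (fun U =>
      ((2 - Real.log (q / p ^ 2)) * outcomeProb U z - p / q * projectedPurity U z - p)
        / Real.log 2) (haarUnitary (Qubits NA × Qubits NB)) := fun z =>
    ((((continuous_outcomeProb z).integrable_haarUnitary.const_mul _).sub
      ((integrable_projectedPurity z).const_mul _)).sub (integrable_const _)).div_const _
  have hz : ∀ z : Qubits NB, -p * Real.logb 2 (q / p ^ 2) ≤ ∫ U,
      ((2 - Real.log (q / p ^ 2)) * outcomeProb U z - p / q * projectedPurity U z - p)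
        / Real.log 2 ∂(haarUnitary (Qubits NA × Qubits NB)) := by
    intro z
    have i1 := (continuous_outcomeProb (NA := NA) z).integrable_haarUnitary.const_mul
      (2 - Real.log (q / p ^ 2))
    have i2 := (integrable_projectedPurity (NA := NA) z).const_mul (p / q)
    have i3 := i1.sub i2
    simp only [Pi.sub_def] at i3
    rw [integral_div, integral_sub i3 (integrable_const _), integral_sub i1 i2,
      integral_const_mul, integral_const_mul, integral_outcomeProb, integral_const, ← hp,
      le_div_iff₀ hl, Real.logb, mul_assoc, div_mul_cancel₀ _ hl.ne']
    -- Since E P = p exactly and (p/q) E Q ≤ p, the terms 2p - p - p cancel and only the logarithm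
    -- is left.
    have hle := mul_le_mul_of_nonneg_left (integral_projectedPurity_le (NA := NA) z)
      (div_pos hp0 hq0).le
    rw [← hq, div_mul_cancel₀ _ hq0.ne'] at hle
    simp only [probReal_univ, smul_eq_mul, one_mul]
    linarith
  calc 2 * ((NA : ℝ) - 1) - 2 * Real.logb 2 (1 - 1 / (2 * (2 : ℝ) ^ NB))
      = ∑ _z : Qubits NB, 2 * (-p * Real.logb 2 (q / p ^ 2)) := by
        have e : q / p ^ 2 = 2 * (1 - 1 / (2 * (2 : ℝ) ^ NB)) / 2 ^ NA := by
          rw [hq, hp]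
          field_simp
        have hpos : 0 < 1 - 1 / (2 * (2 : ℝ) ^ NB) := by
          rw [mul_comm, ← div_div]
          linarith
        rw [e, Real.logb_div (by positivity) hn.ne', Real.logb_mul two_ne_zero hpos.ne',
          Real.logb_pow, Real.logb_self_eq_one one_lt_two]
        simp [hp]
        field_simp
        ring
    _ ≤ ∑ z : Qubits NB, 2 * ∫ U,
          ((2 - Real.log (q / p ^ 2)) * outcomeProb U z - p / q * projectedPurity U z - p)
          / Real.log 2 ∂(haarUnitary (Qubits NA × Qubits NB)) :=
        Finset.sum_le_sum fun z _ => mul_le_mul_of_nonneg_left (hz z) two_pos.le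
    _ = ∫ U, ∑ z : Qubits NB, 2 *
          (((2 - Real.log (q / p ^ 2)) * outcomeProb U z - p / q * projectedPurity U z - p)
          / Real.log 2) ∂(haarUnitary (Qubits NA × Qubits NB)) := by
        rw [integral_finsetSum _ fun z _ => (hint z).const_mul 2]
        simp only [integral_const_mul]
    _ ≤ _ := by
        refine integral_mono (integrable_finsetSum _ fun z _ => (hint z).const_mul 2)
          (integrable_avgTwiceRenyi2 NA NB) fun U => Finset.sum_le_sum fun z _ => ?_
        have := affine_le_outcomeProb_mul_renyi2 U z hp0 hq0
        linarith

end HaarAverage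

/-! ### Decrease of the mutual information. -/

theorem one_sub_inv_pos_and_le_one (NB : ℕ) :
    0 < 1 - 1 / (2 * (2 : ℝ) ^ NB) ∧ 1 - 1 / (2 * (2 : ℝ) ^ NB) ≤ 1 := by
  have hk : (1 : ℝ) ≤ 2 ^ NB := one_le_pow₀ one_le_two
  have h1 : 1 / (2 * (2 : ℝ) ^ NB) < 1 := by
    rw [div_lt_one (by positivity)]
    linarith
  have h0 : 0 < 1 / (2 * (2 : ℝ) ^ NB) := by positivity
  constructor <;> linarith

theorem mutualInfo_sub_integral_le_two (NA NB : ℕ) :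
    mutualInfo (pureDensity (maxEntangled NA))
      - ∫ U, avgMutualInfo U ∂(haarUnitary (Qubits NA × Qubits NB)) ≤ 2 := by
  have h1 := le_integral_avgTwiceRenyi2 NA NB
  have h2 := integral_mono (integrable_avgTwiceRenyi2 NA NB) (integrable_avgMutualInfo NA NB)
    avgTwiceRenyi2_le_avgMutualInfo
  have h3 := Real.logb_nonpos one_lt_two (one_sub_inv_pos_and_le_one NB).1.le
    (one_sub_inv_pos_and_le_one NB).2
  rw [mutualInfo_maxEntangled]
  linarith

theorem lemma1 :
    -- for every single unitary
    (∀ (NA NB : ℕ) (U : Matrix.unitaryGroup (Qubits NA × Qubits NB) ℂ),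
      avgTwiceRenyi2 U ≤ avgMutualInfo U) ∧
    -- the averages over the unitary are genuine integrals
    (∀ NA NB : ℕ,
      Integrable (fun U => avgMutualInfo U) (haarUnitary (Qubits NA × Qubits NB)) ∧
      Integrable (fun U => avgTwiceRenyi2 U) (haarUnitary (Qubits NA × Qubits NB))) ∧
    -- the lower bound, with an error term that is uniform in the size of the ancilla
    (∃ C : ℝ, 0 ≤ C ∧ ∀ NA NB : ℕ,
      (∫ U, avgTwiceRenyi2 U ∂(haarUnitary (Qubits NA × Qubits NB)))
        ≤ ∫ U, avgMutualInfo U ∂(haarUnitary (Qubits NA × Qubits NB)) ∧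
      2 * ((NA : ℝ) - 1)
          - 2 * Real.logb 2 (1 - 1 / (2 * (2 : ℝ) ^ NB) + C / ((2 : ℝ) ^ NA) ^ 2)
        ≤ ∫ U, avgTwiceRenyi2 U ∂(haarUnitary (Qubits NA × Qubits NB))) ∧
    -- the initial mutual information
    (∀ NA : ℕ, mutualInfo (pureDensity (maxEntangled NA)) = 2 * (NA : ℝ)) ∧
    -- its decrease is at most 2 up to an error that vanishes uniformly in the size of the ancilla
    (∃ C : ℝ, 0 ≤ C ∧ ∀ NA NB : ℕ,
      mutualInfo (pureDensity (maxEntangled NA))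
          - ∫ U, avgMutualInfo U ∂(haarUnitary (Qubits NA × Qubits NB))
        ≤ 2 + C / ((2 : ℝ) ^ NA) ^ 2) ∧
    -- and at most 2 for each ancilla, once the data system is large enough
    (∀ NB : ℕ, ∀ᶠ NA : ℕ in atTop,
      mutualInfo (pureDensity (maxEntangled NA))
          - ∫ U, avgMutualInfo U ∂(haarUnitary (Qubits NA × Qubits NB))
        ≤ 2) := by
  -- Both constants are 0, and the eventual statement holds for every `NA`: 1 - 1/(2 d_B) ≤ 1 makes
  -- its logarithm nonpositive.
  refine ⟨fun NA NB U => avgTwiceRenyi2_le_avgMutualInfo U,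
    fun NA NB => ⟨integrable_avgMutualInfo NA NB, integrable_avgTwiceRenyi2 NA NB⟩,
    ⟨0, le_rfl, fun NA NB => ⟨integral_mono (integrable_avgTwiceRenyi2 NA NB)
      (integrable_avgMutualInfo NA NB) avgTwiceRenyi2_le_avgMutualInfo, ?_⟩⟩,
    mutualInfo_maxEntangled, ⟨0, le_rfl, fun NA NB => ?_⟩,
    fun NB => Eventually.of_forall fun NA => mutualInfo_sub_integral_le_two NA NB⟩
  · rw [zero_div, add_zero]
    exact le_integral_avgTwiceRenyi2 NA NB
  · rw [zero_div, add_zero]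
    exact mutualInfo_sub_integral_le_two NA NB
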